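/- Let $d\ge 1$ be an integer and let $\psi\colon[0,\infty)\to[0,\infty)$ be a gauge function, that is, a non-decreasing function with $\psi(0)=0$. Assume that $\lim_{r\to 0+}\psi(r)/r^{d+1}=\infty$. Then for the prevalent $f\in C([0,1],\mathbb{R}^d)$ we have $$\mathcal{H}^{\psi}(\operatorname{graph}(f))>0.$$ Here $C([0,1],\mathbb{R}^d)$ is the additive group of continuous maps with the topology of uniform convergence, $\operatorname{graph}(f)=\{(x,f(x)):x\in[0,1]\}\subset[0,1]\times\mathbb{R}^d$ carries the Euclidean metric, and $$\mathcal{H}^{\psi}(X)=\lim_{\delta\to0+}\inf\Big\{\sum_{i=1}^{\infty}\psi(\operatorname{diam}A_i): X\subset\bigcup_{i=1}^{\infty}A_i,\ \operatorname{diam}A_i\le\delta\text{ for all }i\Big\}.$$ A property holds for the prevalent element of an abelian Polish group $G$ if the set $A$ of elements failing it is shy: there are a Borel set $B\supset A$ and a Borel probability measure $\mu$ on $G$ such that $\mu(B+x)=0$ for all $x\in G$. -/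

import Mathlib

open MeasureTheory Filter Topology
open scoped NNReal ENNReal unitInterval

/-- A subset `A` of an abelian Polish group `G` is *shy* (Haar null) if it is contained in a Borel
set `B` all of whose translates are null for some fixed Borel probability measure on `G`. -/
def IsShy {G : Type*} [AddCommGroup G] [TopologicalSpace G] [IsTopologicalAddGroup G]
    [PolishSpace G] (A : Set G) : Prop :=
  ∃ (B : Set G) (μ : @Measure G (borel G)),
    MeasurableSet[borel G] B ∧ μ Set.univ = 1 ∧ A ⊆ B ∧
      ∀ x : G, μ ((fun b => b + x) '' B) = 0

/-- A set is *prevalent* if its complement is shy. -/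
def IsPrevalent {G : Type*} [AddCommGroup G] [TopologicalSpace G] [IsTopologicalAddGroup G]
    [PolishSpace G] (A : Set G) : Prop :=
  IsShy Aᶜ

/-- A *gauge function*: a non-decreasing `φ : [0, ∞) → [0, ∞)` with `φ 0 = 0`. -/
structure IsGauge (φ : ℝ≥0 → ℝ≥0) : Prop where
  mono : Monotone φ
  zero : φ 0 = 0

/-- The `φ`-Hausdorff (outer) measure: the limit as `δ → 0+` of the infimum of `∑ φ (diam Aᵢ)` over
countable covers by sets `Aᵢ` of diameter at most `δ`. (The value of the extended gauge at `∞` is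
irrelevant, as only sets of small diameter are used.) -/
noncomputable def gaugeHausdorff {X : Type*} [MetricSpace X] (φ : ℝ≥0 → ℝ≥0) : OuterMeasure X :=
  OuterMeasure.mkMetric fun r : ℝ≥0∞ => (φ r.toNNReal : ℝ≥0∞)

/-- The graph of `f : [0,1] → ℝᵈ`, a subset of `[0,1] × ℝᵈ` with the `ℓ²` product metric. -/
def graphSet {d : ℕ} (f : C(I, EuclideanSpace ℝ (Fin d))) :
    Set (WithLp 2 (I × EuclideanSpace ℝ (Fin d))) :=
  {p | p.snd = f p.fst}

/-! The witness measure is the law of a random series `F = ∑ 2⁻ⁿ Xₙ` with independent terms. Off a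
set of small measure, `Xₙ` takes independent uniform values in `[0,1]ᵈ` on very short blocks of
`[0,1]`. Fix a translate and freeze every term but the `n`-th. A cell of mesh `ρₙ` then receives
expected Lebesgue mass at most `cₙ = ρₙ(ρₙ/2⁻ⁿ)ᵈ` from the graph. Short blocks make the variance
small, so by Chebyshev all cells have mass at most `2cₙ`, outside an event of probability at most
`2⁻ⁿ` (`IsBlockField.measure_exists_lt_volume_cell_le`). By Borel–Cantelli this holds almost surely
for all large `n`.

Cell bounds at the scales `ρₙ` bound the mass of balls of radius `r` by a constant depending on `n`
times `r ^ (d + 1)`. That constant is at most `ψ r / r ^ (d + 1)` because `ρₙ` is chosen small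
enough (`mem_dominatedSet_of_volume_cell_le`). The mass distribution principle
(`volume_le_gaugeHausdorff_graphSet`) then gives positive `ψ`-measure. -/

/-! ### Grid cells and uniform variables -/

lemma volume_floor_affine_eq_le {ρ a : ℝ} (hρ : 0 < ρ) (ha : 0 < a) (y : ℝ) (j : ℤ) :
    volume {s : I | ⌊(a * s + y) / ρ⌋ = j} ≤ ENNReal.ofReal (ρ / a) := by
  rw [unitInterval.volume_apply]
  calc volume (Subtype.val '' {s : I | ⌊(a * s + y) / ρ⌋ = j})
      ≤ volume (Set.Ico ((j * ρ - y) / a) (((j + 1) * ρ - y) / a)) := by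
        refine measure_mono ?_
        rintro _ ⟨s, hs, rfl⟩
        rw [Set.mem_ofPred_eq, Int.floor_eq_iff, le_div_iff₀ hρ, div_lt_iff₀ hρ] at hs
        rw [Set.mem_Ico, div_le_iff₀ ha, lt_div_iff₀ ha]
        constructor <;> linarith [hs.1, hs.2]
    _ = ENNReal.ofReal (ρ / a) := by rw [Real.volume_Ico]; ring_nf

lemma volume_floor_div_eq_le {ρ : ℝ} (hρ : 0 < ρ) (j : ℤ) :
    volume {s : I | ⌊(s : ℝ) / ρ⌋ = j} ≤ ENNReal.ofReal ρ := by
  simpa using volume_floor_affine_eq_le hρ one_pos 0 j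

lemma volume_floor_affine_pi_le {d : ℕ} {ρ a : ℝ} (hρ : 0 < ρ) (ha : 0 < a) (y : Fin d → ℝ)
    (q : Fin d → ℤ) :
    volume {v : Fin d → I | ∀ k, ⌊(a * v k + y k) / ρ⌋ = q k} ≤ ENNReal.ofReal (ρ / a) ^ d := by
  have : {v : Fin d → I | ∀ k, ⌊(a * v k + y k) / ρ⌋ = q k} =
      Set.univ.pi fun k => {s : I | ⌊(a * s + y k) / ρ⌋ = q k} := by ext; simp
  rw [this, volume_pi_pi]
  refine (Finset.prod_le_prod' fun k _ => volume_floor_affine_eq_le hρ ha (y k) (q k)).trans ?_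
  simp

/-! ### Block fields -/

/-- A continuous random field taking independent uniform values on small blocks of `[0,1]`,
apart from a set of small measure. -/
structure IsBlockField {d : ℕ} (b : ℝ) (M : ℕ) (ι : I → ℕ) (G : Set I)
    (X : C(ℕ → Fin d → I, C(I, EuclideanSpace ℝ (Fin d)))) : Prop where
  measurable_index : Measurable ι
  measurableSet : MeasurableSet G
  index_lt : ∀ s, ι s < M
  volume_block_le : ∀ i, volume {s | ι s = i} ≤ ENNReal.ofReal b
  norm_le : ∀ u, ‖X u‖ ≤ √d
  apply_eq : ∀ u, ∀ s ∈ G, ∀ k, X u s k = u (ι s) k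

lemma exists_isBlockField (d : ℕ) {b : ℝ} (hb : 0 < b) {ε : ℝ≥0∞} (hε : ε ≠ 0) :
    ∃ M ι G, ∃ X : C(ℕ → Fin d → I, C(I, EuclideanSpace ℝ (Fin d))),
      IsBlockField b M ι G X ∧ volume Gᶜ ≤ ε := by
  classical
  set ι : I → ℕ := fun s => ⌊(s : ℝ) / b⌋₊ with hι
  set M : ℕ := ⌊1 / b⌋₊ + 1 with hM
  have hιm : Measurable ι := by fun_prop
  have hlt : ∀ s, ι s < M := fun s =>
    Nat.lt_succ_of_le (Nat.floor_le_floor (by gcongr; exact s.2.2))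
  have hblock : ∀ i, MeasurableSet {s | ι s = i} := fun i => hιm (measurableSet_singleton i)
  have hδ : ε / (M : ℝ≥0∞) ≠ 0 := ENNReal.div_ne_zero.2 ⟨hε, ENNReal.natCast_ne_top M⟩
  -- Inner regularity: shrinking the `M` blocks to disjoint compact cores costs at most `ε / M` each
  -- and leaves room to interpolate continuously between them.
  choose K hKsub hKc hKvol using fun i => (hblock i).exists_isCompact_sdiff_lt
    (μ := (volume : Measure I)) (measure_ne_top _ _) hδ
  have hdisj : ∀ i s, s ∈ K i → ι s = i := fun i s hs => hKsub i hs
  have hclosed : ∀ i, IsClosed (⋃ j ∈ (Finset.range M).erase i, K j) := fun i =>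
    Set.Finite.isClosed_biUnion (Finset.finite_toSet _) fun j _ => (hKc j).isClosed
  choose χ hχ0 hχ1 _ using fun i => exists_continuous_zero_one_of_isClosed
    (hclosed i) (hKc i).isClosed (by
      rw [Set.disjoint_left]
      simp only [Set.mem_iUnion, Finset.mem_erase]
      rintro s ⟨j, ⟨hji, -⟩, hs⟩ hs'
      exact hji ((hdisj j s hs).symm.trans (hdisj i s hs')))
  -- On a core the sum reduces to one uniform value; clamping to `[0,1]` gives the norm bound
  -- elsewhere and changes nothing on the cores.
  let Y : C((ℕ → Fin d → I) × I, EuclideanSpace ℝ (Fin d)) :=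
    ⟨fun p => WithLp.toLp 2 fun k =>
      max 0 (min 1 (∑ i ∈ Finset.range M, χ i p.2 * (p.1 i k : ℝ))), by fun_prop⟩
  refine ⟨M, ι, ⋃ i ∈ Finset.range M, K i, Y.curry,
    ⟨hιm, ?_, hlt, fun i => ?_, fun u => ?_, fun u s hs k => ?_⟩, ?_⟩
  · exact Finset.measurableSet_biUnion _ fun i _ => (hKc i).measurableSet
  · refine (measure_mono fun s hs => ?_).trans (volume_floor_div_eq_le hb (i : ℤ))
    have h0 : (0 : ℝ) ≤ s / b := div_nonneg s.2.1 hb.le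
    have : ⌊(s : ℝ) / b⌋₊ = i := hs
    change ⌊(s : ℝ) / b⌋ = i
    rw [← this, Int.natCast_floor_eq_floor h0]
  · refine (ContinuousMap.norm_le _ (Real.sqrt_nonneg _)).2 fun s => ?_
    rw [EuclideanSpace.norm_eq]
    refine Real.sqrt_le_sqrt ?_
    calc _ ≤ ∑ _k : Fin d, (1 : ℝ) := by
          refine Finset.sum_le_sum fun k _ => ?_
          rw [Real.norm_eq_abs, sq_abs]
          have h0 : 0 ≤ Y.curry u s k := le_max_left _ _
          have h1 : Y.curry u s k ≤ 1 := max_le zero_le_one (min_le_left _ _)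
          exact pow_le_one₀ h0 h1
      _ = d := by simp
  · simp only [Set.mem_iUnion, Finset.mem_range] at hs
    obtain ⟨i, hi, hs⟩ := hs
    have hsum : ∑ j ∈ Finset.range M, χ j s * (u j k : ℝ) = u i k := by
      rw [Finset.sum_eq_single_of_mem i (Finset.mem_range.2 hi), hχ1 i hs]
      · simp
      · intro j _ hji
        rw [hχ0 j (Set.mem_biUnion (x := i) (by simp [hji.symm, hi]) hs)]
        simp
    change max 0 (min 1 (∑ j ∈ Finset.range M, χ j s * (u j k : ℝ))) = _
    rw [hsum, hdisj i s hs, min_eq_right (u i k).2.2, max_eq_right (u i k).2.1]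
  · calc volume (⋃ i ∈ Finset.range M, K i)ᶜ
        ≤ volume (⋃ i ∈ Finset.range M, {s | ι s = i} \ K i) := by
          refine measure_mono fun s hs => ?_
          simp only [Set.mem_compl_iff, Set.mem_iUnion, not_exists] at hs
          simp only [Set.mem_iUnion]
          exact ⟨ι s, Finset.mem_range.2 (hlt s), rfl, hs _ (Finset.mem_range.2 (hlt s))⟩
      _ ≤ ∑ i ∈ Finset.range M, volume ({s | ι s = i} \ K i) := measure_biUnion_finset_le _ _
      _ ≤ ∑ _i ∈ Finset.range M, ε / M := Finset.sum_le_sum fun i _ => (hKvol i).le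
      _ = ε := by
          rw [Finset.sum_const, Finset.card_range, nsmul_eq_mul]
          exact ENNReal.mul_div_cancel (by simp [hM]) (ENNReal.natCast_ne_top M)

/-! ### Concentration of cell masses -/

/-- Chebyshev: as the mean is at most `c`, exceeding `2 * c` forces a deviation of at least `c`.
Independence and `0 ≤ F ≤ b` bound the variance by `b` times the mean. The mean is kept as a factor
so that the bounds can later be summed over infinitely many cells. -/
lemma measure_two_mul_lt_sum_le {Ω : Type*} [MeasurableSpace Ω] (P : Measure Ω)
    [IsProbabilityMeasure P] {F : ℕ → Ω → ℝ} (hF : ∀ i, Measurable (F i)) {b c : ℝ}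
    (hF0 : ∀ i v, 0 ≤ F i v) (hFb : ∀ i v, F i v ≤ b) (hc : 0 < c) (M : ℕ)
    (hmean : ∫ u, ∑ i ∈ Finset.range M, F i (u i) ∂(Measure.infinitePi fun _ : ℕ => P) ≤ c) :
    Measure.infinitePi (fun _ : ℕ => P) {u | 2 * c < ∑ i ∈ Finset.range M, F i (u i)} ≤
      ENNReal.ofReal (b / c ^ 2 *
        ∫ u, ∑ i ∈ Finset.range M, F i (u i) ∂(Measure.infinitePi fun _ : ℕ => P)) := by
  set π := Measure.infinitePi fun _ : ℕ => P
  let Y : ℕ → (ℕ → Ω) → ℝ := fun i u => F i (u i)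
  have hYm : ∀ i, Measurable (Y i) := fun i => (hF i).comp (measurable_pi_apply i)
  have hY : ∀ i (p : ℝ≥0∞), MemLp (Y i) p π := fun i p =>
    MemLp.of_bound (hYm i).aestronglyMeasurable b (ae_of_all _ fun u => by
      rw [Real.norm_eq_abs, abs_of_nonneg (hF0 _ _)]; exact hFb _ _)
  have hYint : ∀ i, Integrable (Y i) π := fun i => memLp_one_iff_integrable.1 (hY i 1)
  have hind : ProbabilityTheory.iIndepFun Y π :=
    ProbabilityTheory.iIndepFun_infinitePi (X := F) hF
  set Z : (ℕ → Ω) → ℝ := ∑ i ∈ Finset.range M, Y i with hZ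
  have hZe : ∀ u, Z u = ∑ i ∈ Finset.range M, F i (u i) := fun u => by
    simp [hZ, Y, Finset.sum_apply]
  have hZL : MemLp Z 2 π := memLp_finsetSum' _ fun i _ => hY i 2
  have hvar : ProbabilityTheory.variance Z π ≤ b * ∫ u, Z u ∂π := by
    rw [hZ, ProbabilityTheory.IndepFun.variance_sum (fun i _ => hY i 2)
      (fun i _ j _ hij => hind.indepFun hij)]
    simp only [Finset.sum_apply]
    rw [integral_finsetSum _ fun i _ => hYint i, Finset.mul_sum]
    refine Finset.sum_le_sum fun i _ => ?_
    refine (ProbabilityTheory.variance_le_expectation_sq (hYm i).aestronglyMeasurable).trans ?_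
    rw [← integral_const_mul]
    refine integral_mono (hY i 2).integrable_sq ((hYint i).const_mul b) fun u => ?_
    simp only [Pi.pow_apply, sq]
    exact mul_le_mul_of_nonneg_right (hFb _ _) (hF0 _ _)
  simp only [← hZe] at hmean ⊢
  calc π {u | 2 * c < Z u} ≤ π {u | c ≤ |Z u - ∫ u, Z u ∂π|} := by
        refine measure_mono fun u hu => ?_
        have : 2 * c < Z u := hu
        have h' : c ≤ Z u - ∫ u, Z u ∂π := by linarith
        exact h'.trans (le_abs_self _)
    _ ≤ ENNReal.ofReal (ProbabilityTheory.variance Z π / c ^ 2) :=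
        ProbabilityTheory.meas_ge_le_variance_div_sq hZL hc
    _ ≤ _ := by
        refine ENNReal.ofReal_le_ofReal ?_
        rw [div_mul_eq_mul_div]
        gcongr

/-- The cell of the grid of mesh `ρ` in `[0,1] × ℝᵈ` that contains the point `(s, y)`. -/
noncomputable def gridCell {d : ℕ} (ρ : ℝ) (s : I) (y : EuclideanSpace ℝ (Fin d)) :
    ℤ × (Fin d → ℤ) :=
  (⌊(s : ℝ) / ρ⌋, fun k => ⌊y k / ρ⌋)

lemma measurable_gridCell {d : ℕ} (ρ : ℝ) :
    Measurable fun p : I × EuclideanSpace ℝ (Fin d) => gridCell ρ p.1 p.2 := by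
  unfold gridCell
  refine Measurable.prodMk (by fun_prop) (measurable_pi_lambda _ fun k => ?_)
  have : Measurable fun p : I × EuclideanSpace ℝ (Fin d) => p.2 k :=
    Continuous.measurable (by fun_prop)
  exact Int.measurable_floor.comp (this.div_const ρ)

lemma measurableSet_gridCell_eq {d : ℕ} {Ω : Type*} [MeasurableSpace Ω] [TopologicalSpace Ω]
    [BorelSpace Ω] [SecondCountableTopology Ω] (ρ : ℝ) {G : Set I} (hG : MeasurableSet G)
    {f : Ω → C(I, EuclideanSpace ℝ (Fin d))} (hf : Continuous f) (q : ℤ × (Fin d → ℤ)) :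
    MeasurableSet {p : Ω × I | p.2 ∈ G ∧ gridCell ρ p.2 (f p.1 p.2) = q} := by
  have hm : Measurable fun p : Ω × I => (p.2, f p.1 p.2) :=
    measurable_snd.prodMk (Continuous.measurable (by fun_prop))
  exact (measurable_snd hG).inter ((measurable_gridCell ρ).comp hm (measurableSet_singleton q))

lemma IsBlockField.measure_exists_lt_volume_cell_le {d : ℕ} {b : ℝ} {M : ℕ} {ι : I → ℕ} {G : Set I}
    {X : C(ℕ → Fin d → I, C(I, EuclideanSpace ℝ (Fin d)))} (hX : IsBlockField b M ι G X)
    (hb : 0 ≤ b) {ρ a c : ℝ} (hρ : 0 < ρ) (ha : 0 < a) (hc : c = ρ * (ρ / a) ^ d)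
    (h : C(I, EuclideanSpace ℝ (Fin d))) :
    Measure.infinitePi (fun _ : ℕ => (volume : Measure (Fin d → I)))
      {u | ∃ q, ENNReal.ofReal (2 * c) <
        volume {s | s ∈ G ∧ gridCell ρ s ((a • X u + h) s) = q}} ≤ ENNReal.ofReal (b / c ^ 2) := by
  set π := Measure.infinitePi fun _ : ℕ => (volume : Measure (Fin d → I))
  have hc0 : 0 < c := by rw [hc]; positivity
  let V : ℤ × (Fin d → ℤ) → (ℕ → Fin d → I) → ℝ≥0∞ := fun q u =>
    volume {s | s ∈ G ∧ gridCell ρ s ((a • X u + h) s) = q}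
  have hcont : Continuous fun u => a • X u + h := by fun_prop
  have hT : ∀ q, MeasurableSet {p : (ℕ → Fin d → I) × I |
      p.2 ∈ G ∧ gridCell ρ p.2 ((a • X p.1 + h) p.2) = q} :=
    measurableSet_gridCell_eq ρ hX.measurableSet hcont
  have hVm : ∀ q, Measurable (V q) := fun q => measurable_measure_prodMk_left (hT q)
  have hVmean : ∀ q, ∫⁻ u, V q u ∂π ≤ ENNReal.ofReal c := by
    intro q
    -- Fubini: for each fixed `s ∈ G` the value of the field at `s` is uniform, whatever the shift
    -- `h`.
    calc ∫⁻ u, V q u ∂π = ∫⁻ s, π {u | s ∈ G ∧ gridCell ρ s ((a • X u + h) s) = q} := by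
          exact (Measure.prod_apply (hT q)).symm.trans (Measure.prod_apply_symm (hT q))
      _ ≤ ∫⁻ s, Set.indicator {s : I | ⌊(s : ℝ) / ρ⌋ = q.1}
            (fun _ => ENNReal.ofReal (ρ / a) ^ d) s := by
          refine lintegral_mono fun s => ?_
          by_cases hs : ⌊(s : ℝ) / ρ⌋ = q.1
          · rw [Set.indicator_of_mem (by exact hs)]
            by_cases hsG : s ∈ G
            · calc _ ≤ π ((fun u => u (ι s)) ⁻¹' {v : Fin d → I |
                      ∀ k, ⌊(a * v k + h s k) / ρ⌋ = q.2 k}) := by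
                    refine measure_mono fun u hu k => ?_
                    have := congrFun (congrArg Prod.snd hu.2) k
                    simpa [gridCell, hX.apply_eq u s hsG k] using this
                _ = volume {v : Fin d → I | ∀ k, ⌊(a * v k + h s k) / ρ⌋ = q.2 k} := by
                    refine (measurePreserving_eval_infinitePi
                      (fun _ : ℕ => (volume : Measure (Fin d → I))) (ι s)).measure_preimage ?_
                    refine MeasurableSet.nullMeasurableSet ?_
                    rw [Set.ofPred_forall]
                    exact MeasurableSet.iInter fun k =>
                      (by fun_prop : Measurable fun v : Fin d → I => ⌊(a * v k + h s k) / ρ⌋)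
                        (measurableSet_singleton _)
                _ ≤ _ := volume_floor_affine_pi_le hρ ha _ _
            · simp [hsG]
          · have : {u | s ∈ G ∧ gridCell ρ s ((a • X u + h) s) = q} = ∅ := by
              refine Set.eq_empty_of_forall_notMem fun u hu => hs (congrArg Prod.fst hu.2)
            rw [this]; simp
      _ = ENNReal.ofReal (ρ / a) ^ d * volume {s : I | ⌊(s : ℝ) / ρ⌋ = q.1} := by
          rw [lintegral_indicator_const]
          exact (by fun_prop : Measurable fun s : I => ⌊(s : ℝ) / ρ⌋) (measurableSet_singleton _)
      _ ≤ ENNReal.ofReal (ρ / a) ^ d * ENNReal.ofReal ρ := by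
          gcongr; exact volume_floor_div_eq_le hρ _
      _ = ENNReal.ofReal c := by
          rw [hc, mul_comm, ENNReal.ofReal_mul hρ.le, ENNReal.ofReal_pow (by positivity)]
  -- The part of the cell's mass coming from block `i`. The field is replaced by the constant vector
  -- `v`, so it depends on `u i` alone and the blocks contribute independently.
  let A : ℤ × (Fin d → ℤ) → ℕ → (Fin d → I) → Set I := fun q i v =>
    {s | s ∈ G ∩ {s | ι s = i} ∧
      gridCell ρ s (a • WithLp.toLp 2 (fun k => (v k : ℝ)) + h s) = q}
  have hind : ∀ i, MeasurableSet {s | ι s = i} := fun i =>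
    hX.measurable_index (measurableSet_singleton i)
  have hAjoint : ∀ q i, MeasurableSet {p : (Fin d → I) × I | p.2 ∈ A q i p.1} := by
    intro q i
    have hm : Measurable fun p : (Fin d → I) × I =>
        (p.2, a • WithLp.toLp 2 (fun k => (p.1 k : ℝ)) + h p.2) :=
      measurable_snd.prodMk (Continuous.measurable (by fun_prop))
    exact (measurable_snd (hX.measurableSet.inter (hind i))).inter
      ((measurable_gridCell ρ).comp hm (measurableSet_singleton q))
  have hAm : ∀ q i v, MeasurableSet (A q i v) := fun q i v =>
    measurable_prodMk_left (x := v) (hAjoint q i)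
  let F : ℤ × (Fin d → ℤ) → ℕ → (Fin d → I) → ℝ := fun q i v => (volume (A q i v)).toReal
  have hFm : ∀ q i, Measurable (F q i) := fun q i =>
    (measurable_measure_prodMk_left (hAjoint q i)).ennreal_toReal
  have hFb : ∀ q i v, F q i v ≤ b := fun q i v => by
    refine ENNReal.toReal_le_of_le_ofReal hb
      ((measure_mono fun s hs => ?_).trans (hX.volume_block_le i))
    exact hs.1.2
  have hVsum : ∀ q u, (V q u).toReal = ∑ i ∈ Finset.range M, F q i (u i) := by
    intro q u
    have hset : {s | s ∈ G ∧ gridCell ρ s ((a • X u + h) s) = q} =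
        ⋃ i ∈ Finset.range M, A q i (u i) := by
      ext s
      have hval : s ∈ G → (a • X u + h) s =
          a • WithLp.toLp 2 (fun k => (u (ι s) k : ℝ)) + h s := fun hs => by
        ext k
        simp [hX.apply_eq u s hs k]
      simp only [Set.mem_iUnion, Finset.mem_range]
      constructor
      · rintro ⟨hs, hq⟩
        exact ⟨ι s, hX.index_lt s, ⟨hs, rfl⟩, by rw [← hval hs]; exact hq⟩
      · rintro ⟨i, -, ⟨hs, rfl⟩, hq⟩
        exact ⟨hs, by rw [hval hs]; exact hq⟩
    change (volume _).toReal = _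
    rw [hset, measure_biUnion_finset _ fun i _ => hAm q i (u i),
      ENNReal.toReal_sum fun i _ => measure_ne_top _ _]
    intro i _ j _ hij
    rw [Function.onFun, Set.disjoint_left]
    exact fun s hs hs' => hij (hs.1.2.symm.trans hs'.1.2)
  have hVint : ∀ q, ∫ u, ∑ i ∈ Finset.range M, F q i (u i) ∂π = (∫⁻ u, V q u ∂π).toReal := by
    intro q
    simp only [← hVsum]
    exact integral_toReal (hVm q).aemeasurable (ae_of_all _ fun u => measure_lt_top _ _)
  have hVtop : ∀ q, ∫⁻ u, V q u ∂π ≠ ∞ := fun q =>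
    ((hVmean q).trans_lt ENNReal.ofReal_lt_top).ne
  have hcheb : ∀ q, π {u | ENNReal.ofReal (2 * c) < V q u} ≤
      ENNReal.ofReal (b / c ^ 2) * ∫⁻ u, V q u ∂π := by
    intro q
    have key := measure_two_mul_lt_sum_le (volume : Measure (Fin d → I)) (hFm q)
      (fun i v => ENNReal.toReal_nonneg) (hFb q) hc0 M (by
        rw [hVint q]; exact ENNReal.toReal_le_of_le_ofReal hc0.le (hVmean q))
    rw [hVint q, ENNReal.ofReal_mul (by positivity), ENNReal.ofReal_toReal (hVtop q)] at key
    refine (measure_mono fun u hu => ?_).trans key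
    change 2 * c < _
    rw [← hVsum]
    exact (ENNReal.ofReal_lt_iff_lt_toReal (by positivity) (measure_ne_top _ _)).1 hu
  calc π {u | ∃ q, ENNReal.ofReal (2 * c) < V q u}
      = π (⋃ q, {u | ENNReal.ofReal (2 * c) < V q u}) := by rw [Set.ofPred_exists]
    _ ≤ ∑' q, π {u | ENNReal.ofReal (2 * c) < V q u} := measure_iUnion_le _
    _ ≤ ∑' q, ENNReal.ofReal (b / c ^ 2) * ∫⁻ u, V q u ∂π := ENNReal.tsum_le_tsum hcheb
    -- The cells are disjoint, so their masses sum to at most 1; this absorbs the union over all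
    -- `q`.
    _ = ENNReal.ofReal (b / c ^ 2) * ∫⁻ u, ∑' q, V q u ∂π := by
        rw [ENNReal.tsum_mul_left, lintegral_tsum fun q => (hVm q).aemeasurable]
    _ ≤ ENNReal.ofReal (b / c ^ 2) * ∫⁻ _u, 1 ∂π := by
        gcongr with u
        rw [← measure_iUnion]
        · exact prob_le_one
        · intro q q' hq
          rw [Function.onFun, Set.disjoint_left]
          exact fun s hs hs' => hq (hs.2.symm.trans hs'.2)
        · exact fun q => measurable_prodMk_left (x := u) (hT q)
    _ = ENNReal.ofReal (b / c ^ 2) := by simp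

/-! ### Resampling one coordinate of a product measure -/

lemma map_update_prod_infinitePi {κ : Type*} [DecidableEq κ] {Ω : κ → Type*}
    [∀ i, MeasurableSpace (Ω i)] (μ : ∀ i, Measure (Ω i)) [∀ i, IsProbabilityMeasure (μ i)]
    (n : κ) :
    ((Measure.infinitePi μ).prod (μ n)).map (fun p => Function.update p.1 n p.2) =
      Measure.infinitePi μ := by
  have hm : Measurable fun p : (∀ i, Ω i) × Ω n => Function.update p.1 n p.2 :=
    measurable_update'
  refine Measure.eq_infinitePi μ fun s t ht => ?_
  rw [Measure.map_apply hm (MeasurableSet.pi s.countable_toSet fun i _ => ht i)]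
  by_cases hn : n ∈ s
  · have : (fun p : (∀ i, Ω i) × Ω n => Function.update p.1 n p.2) ⁻¹' (s : Set κ).pi t =
        ((s.erase n : Finset κ) : Set κ).pi t ×ˢ t n := by
      ext p
      simp only [Set.mem_preimage, Set.mem_pi, Set.mem_prod, Finset.mem_coe, Finset.mem_erase]
      constructor
      · intro h
        refine ⟨fun i hi => ?_, by simpa using h n hn⟩
        simpa [Function.update_of_ne hi.1] using h i hi.2
      · rintro ⟨h, h'⟩ i hi
        by_cases hin : i = n
        · subst hin; simpa using h'
        · simpa [Function.update_of_ne hin] using h i ⟨hin, hi⟩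
    rw [this, Measure.prod_prod, Measure.infinitePi_pi μ fun i _ => ht i,
      Finset.prod_erase_mul s _ hn]
  · have : (fun p : (∀ i, Ω i) × Ω n => Function.update p.1 n p.2) ⁻¹' (s : Set κ).pi t =
        (s : Set κ).pi t ×ˢ Set.univ := by
      ext p
      simp only [Set.mem_preimage, Set.mem_pi, Set.mem_prod, Finset.mem_coe, Set.mem_univ,
        and_true]
      refine forall₂_congr fun i hi => ?_
      rw [Function.update_of_ne (ne_of_mem_of_not_mem hi hn)]
    rw [this, Measure.prod_prod, Measure.infinitePi_pi μ fun i _ => ht i, measure_univ, mul_one]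

/-- Conditioning on all coordinates but `n`: resampling that coordinate preserves the product
measure, so a uniform bound on the sections suffices. -/
lemma infinitePi_le_of_forall_update {κ : Type*} [DecidableEq κ] {Ω : κ → Type*}
    [∀ i, MeasurableSpace (Ω i)] (μ : ∀ i, Measure (Ω i)) [∀ i, IsProbabilityMeasure (μ i)]
    (n : κ) {T : Set (∀ i, Ω i)} (hT : MeasurableSet T) {c : ℝ≥0∞}
    (h : ∀ ω, μ n {u | Function.update ω n u ∈ T} ≤ c) : Measure.infinitePi μ T ≤ c := by
  have hm : Measurable fun p : (∀ i, Ω i) × Ω n => Function.update p.1 n p.2 :=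
    measurable_update'
  rw [← map_update_prod_infinitePi μ n, Measure.map_apply hm hT, Measure.prod_apply (hm hT)]
  calc _ ≤ ∫⁻ _ω, c ∂(Measure.infinitePi μ) := lintegral_mono fun ω => h ω
    _ = c := by simp

/-! ### Random geometric series -/

section geometricSeries

variable {Ω E : Type*} [NormedAddCommGroup E] [NormedSpace ℝ E]

/-- The sum of independent copies of random vectors with geometrically decaying weights. -/
noncomputable def geometricSum (X : ℕ → Ω → E) (ω : ℕ → Ω) : E :=
  ∑' n, (1 / 2 : ℝ) ^ n • X n (ω n)

lemma norm_smul_le_geometric {X : ℕ → Ω → E} {C : ℝ} (hX : ∀ n u, ‖X n u‖ ≤ C) (n : ℕ) (u : Ω) :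
    ‖(1 / 2 : ℝ) ^ n • X n u‖ ≤ (1 / 2 : ℝ) ^ n * C := by
  rw [norm_smul, Real.norm_of_nonneg (by positivity)]
  gcongr
  exact hX n u

lemma continuous_geometricSum [CompleteSpace E] [TopologicalSpace Ω] {X : ℕ → Ω → E} {C : ℝ}
    (hX : ∀ n u, ‖X n u‖ ≤ C) (hc : ∀ n, Continuous (X n)) : Continuous (geometricSum X) :=
  continuous_tsum (fun n => ((hc n).comp (continuous_apply n)).const_smul _)
    (summable_geometric_two.mul_right C) fun n ω => norm_smul_le_geometric hX n (ω n)

lemma geometricSum_update [CompleteSpace E] {X : ℕ → Ω → E} {C : ℝ} (hX : ∀ n u, ‖X n u‖ ≤ C) (ω : ℕ → Ω) (n : ℕ)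
    (u : Ω) : geometricSum X (Function.update ω n u) =
      (1 / 2 : ℝ) ^ n • X n u + (geometricSum X ω - (1 / 2 : ℝ) ^ n • X n (ω n)) := by
  have hs : ∀ ω : ℕ → Ω, Summable fun n => (1 / 2 : ℝ) ^ n • X n (ω n) := fun ω =>
    Summable.of_norm_bounded (summable_geometric_two.mul_right C)
      fun n => norm_smul_le_geometric hX n (ω n)
  have hdiff : geometricSum X (Function.update ω n u) - geometricSum X ω =
      (1 / 2 : ℝ) ^ n • X n u - (1 / 2 : ℝ) ^ n • X n (ω n) := by
    rw [geometricSum, geometricSum, ← (hs _).tsum_sub (hs _), tsum_eq_single n]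
    · simp
    · intro m hm
      simp [Function.update_of_ne hm]
  rw [← sub_eq_zero] at hdiff ⊢
  rw [← hdiff]
  abel

end geometricSeries

/-! ### Mass distribution principle -/

/-- The functions for which the lift of Lebesgue measure on `G` to the graph is dominated by the
gauge `ψ` at all scales below `r₀`. -/
def dominatedSet {d : ℕ} (G : Set I) (ψ : ℝ≥0 → ℝ≥0) (r₀ : ℝ) :
    Set C(I, EuclideanSpace ℝ (Fin d)) :=
  {f | ∀ r : ℝ≥0, 0 < r → (r : ℝ) < r₀ → ∀ (x : I) (y : EuclideanSpace ℝ (Fin d)),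
    volume {s | (s ∈ G ∧ dist s x < 2 * r) ∧ dist (f s) y < 2 * r} ≤ ψ r}

/-- The strict inequality is an increasing union of conditions with margin `1 / (m + 1)`, and a
uniform approximation within that margin preserves membership; continuity from below passes the
bound to the limit. -/
lemma isClosed_setOf_volume_le {E : Type*} [PseudoMetricSpace E] (A : Set I)
    (y : E) (r : ℝ) (c : ℝ≥0∞) :
    IsClosed {f : C(I, E) | volume {s | s ∈ A ∧ dist (f s) y < r} ≤ c} := by
  refine isClosed_of_closure_subset fun f hf => ?_
  have hunion : {s | s ∈ A ∧ dist (f s) y < r} =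
      ⋃ m : ℕ, {s | s ∈ A ∧ dist (f s) y + 1 / ((m : ℝ) + 1) ≤ r} := by
    ext s
    simp only [Set.mem_iUnion]
    constructor
    · rintro ⟨hs, hr⟩
      obtain ⟨m, hm⟩ := exists_nat_one_div_lt (sub_pos.2 hr)
      exact ⟨m, hs, by linarith⟩
    · rintro ⟨m, hs, hr⟩
      have : (0 : ℝ) < 1 / ((m : ℝ) + 1) := Nat.one_div_pos_of_nat
      exact ⟨hs, by linarith⟩
  have hmono : Monotone fun m : ℕ => {s | s ∈ A ∧ dist (f s) y + 1 / ((m : ℝ) + 1) ≤ r} := by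
    intro m n hmn s hs
    refine ⟨hs.1, le_trans ?_ hs.2⟩
    gcongr
  change volume _ ≤ c
  rw [hunion, hmono.measure_iUnion]
  refine iSup_le fun m => ?_
  obtain ⟨g, hg, hfg⟩ := Metric.mem_closure_iff.1 hf (1 / ((m : ℝ) + 1)) Nat.one_div_pos_of_nat
  refine le_trans (measure_mono fun s hs => ?_) hg
  refine ⟨hs.1, ?_⟩
  calc dist (g s) y ≤ dist (g s) (f s) + dist (f s) y := dist_triangle _ _ _
    _ ≤ dist f g + dist (f s) y := by
        rw [dist_comm]; gcongr; exact ContinuousMap.dist_apply_le_dist s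
    _ < r := by linarith [hs.2]

lemma isClosed_dominatedSet {d : ℕ} (G : Set I) (ψ : ℝ≥0 → ℝ≥0) (r₀ : ℝ) :
    IsClosed (dominatedSet (d := d) G ψ r₀) := by
  simp only [dominatedSet, Set.ofPred_forall]
  exact isClosed_iInter fun r => isClosed_iInter fun _ => isClosed_iInter fun _ =>
    isClosed_iInter fun x => isClosed_iInter fun y =>
      isClosed_setOf_volume_le {s | s ∈ G ∧ dist s x < 2 * r} y _ _

lemma volume_le_gaugeHausdorff_graphSet {d : ℕ} {G : Set I} {ψ : ℝ≥0 → ℝ≥0} {r₀ : ℝ} (hr₀ : 0 < r₀)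
    {f : C(I, EuclideanSpace ℝ (Fin d))} (hf : f ∈ dominatedSet G ψ r₀) :
    volume G ≤ gaugeHausdorff ψ (graphSet f) := by
  let g : I → WithLp 2 (I × EuclideanSpace ℝ (Fin d)) := fun s => WithLp.toLp 2 (s, f s)
  let ν : OuterMeasure (WithLp 2 (I × EuclideanSpace ℝ (Fin d))) :=
    OuterMeasure.map g (volume.restrict G).toOuterMeasure
  have hν : ∀ A, ν A = volume.restrict G (g ⁻¹' A) := fun A => rfl
  have hle : ν ≤ gaugeHausdorff ψ := by
    refine OuterMeasure.le_mkMetric _ ν (ENNReal.ofReal (r₀ / 2))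
      (ENNReal.ofReal_pos.2 (by positivity)) fun A hA => ?_
    rw [hν]
    rcases (g ⁻¹' A).eq_empty_or_nonempty with hemp | ⟨x, hx⟩
    · simp [hemp]
    have htop : Metric.ediam A ≠ ∞ := (hA.trans_lt ENNReal.ofReal_lt_top).ne
    set r : ℝ≥0 := (Metric.ediam A).toNNReal with hr
    have hdiam : Metric.ediam A = r := (ENNReal.coe_toNNReal htop).symm
    have hdist : ∀ s ∈ g ⁻¹' A, dist s x ≤ r ∧ dist (f s) (f x) ≤ r := by
      intro s hs
      have h1 : edist (g s) (g x) ≤ r := hdiam ▸ Metric.edist_le_ediam_of_mem hs hx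
      have h2 : edist (s, f s) (x, f x) ≤ edist (g s) (g x) := by
        have := WithLp.prod_lipschitzWith_ofLp 2 I (EuclideanSpace ℝ (Fin d)) (g s) (g x)
        rwa [ENNReal.coe_one, one_mul] at this
      have h3 := max_le_iff.1 ((Prod.edist_eq _ _).symm.trans_le (h2.trans h1))
      exact ⟨dist_le_coe.2 (edist_le_coe.1 h3.1), dist_le_coe.2 (edist_le_coe.1 h3.2)⟩
    -- At diameter 0 the domination says nothing, but points are Lebesgue null. For `r > 0` the open
    -- balls of radius `2 * r` contain the closed ones of radius `r`.
    rcases eq_or_lt_of_le (zero_le : 0 ≤ r) with h0 | h0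
    · have : g ⁻¹' A ⊆ {x} := fun s hs => by
        have := (hdist s hs).1
        rw [← h0, NNReal.coe_zero] at this
        exact dist_le_zero.1 this
      calc _ ≤ volume.restrict G {x} := measure_mono this
        _ ≤ volume {x} := Measure.restrict_apply_le _ _
        _ = 0 := by simp
        _ ≤ _ := zero_le
    · have hrr : (r : ℝ) < r₀ := by
        rw [hdiam, ← ENNReal.ofReal_coe_nnreal, ENNReal.ofReal_le_ofReal_iff (by positivity)] at hA
        linarith
      have hr0 : (0 : ℝ) < r := h0
      let D : Set I := {s | dist s x < 2 * r ∧ dist (f s) (f x) < 2 * r}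
      have hD : MeasurableSet D :=
        ((isOpen_lt (by fun_prop) continuous_const).inter
          (isOpen_lt (by fun_prop) continuous_const) :
            IsOpen ({s : I | dist s x < 2 * r} ∩ {s | dist (f s) (f x) < 2 * r})).measurableSet
      calc volume.restrict G (g ⁻¹' A) ≤ volume.restrict G D := measure_mono fun s hs =>
            ⟨by linarith [(hdist s hs).1], by linarith [(hdist s hs).2]⟩
        _ = volume (D ∩ G) := Measure.restrict_apply hD
        _ ≤ volume {s | (s ∈ G ∧ dist s x < 2 * r) ∧ dist (f s) (f x) < 2 * r} :=
            measure_mono fun s hs => ⟨⟨hs.2, hs.1.1⟩, hs.1.2⟩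
        _ ≤ ψ r := hf r h0 hrr x (f x)
  refine le_trans (le_of_eq ?_) (hle (graphSet f))
  have : g ⁻¹' graphSet f = Set.univ := by
    ext s; simp [g, graphSet]
  rw [hν, this, Measure.restrict_apply_univ]

/-! ### From cells to balls -/

lemma floor_div_mem_Icc {ρ r x z : ℝ} (hρ : 0 < ρ) (h : |z - x| < 2 * r) :
    ⌊z / ρ⌋ ∈ Finset.Icc ⌊(x - 2 * r) / ρ⌋ ⌊(x + 2 * r) / ρ⌋ := by
  rw [abs_lt] at h
  rw [Finset.mem_Icc]
  constructor <;> refine Int.floor_le_floor (div_le_div_of_nonneg_right ?_ hρ.le) <;> linarith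

/-- An interval of length `4 * r` meets at most `4 * r / ρ + 2` cells, and `2 ≤ 2 * r / ρ`. -/
lemma card_Icc_floor_div_le {ρ r : ℝ} (hρ : 0 < ρ) (hr : ρ ≤ r) (x : ℝ) :
    ((Finset.Icc ⌊(x - 2 * r) / ρ⌋ ⌊(x + 2 * r) / ρ⌋).card : ℝ) ≤ 6 * r / ρ := by
  have h1 : 1 ≤ r / ρ := (one_le_div hρ).2 hr
  have hle : ⌊(x - 2 * r) / ρ⌋ ≤ ⌊(x + 2 * r) / ρ⌋ :=
    Int.floor_le_floor (div_le_div_of_nonneg_right (by linarith) hρ.le)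
  have hcard : ((Finset.Icc ⌊(x - 2 * r) / ρ⌋ ⌊(x + 2 * r) / ρ⌋).card : ℝ) =
      ⌊(x + 2 * r) / ρ⌋ + 1 - ⌊(x - 2 * r) / ρ⌋ := by
    rw [← Int.cast_natCast, Int.card_Icc_of_le _ _ (by linarith)]
    push_cast; ring
  rw [hcard]
  have h2 := Int.floor_le ((x + 2 * r) / ρ)
  have h3 := Int.sub_one_lt_floor ((x - 2 * r) / ρ)
  have h4 : (x + 2 * r) / ρ - (x - 2 * r) / ρ = 4 * (r / ρ) := by ring
  rw [mul_div_assoc]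
  linarith

lemma volume_ball_le_of_volume_cell_le {d : ℕ} {G : Set I}
    {f : C(I, EuclideanSpace ℝ (Fin d))} {ρ r : ℝ} (hρ : 0 < ρ) (hr : ρ ≤ r) {m : ℝ} (hm : 0 ≤ m)
    (hcell : ∀ q, volume {s | s ∈ G ∧ gridCell ρ s (f s) = q} ≤ ENNReal.ofReal m)
    (x : I) (y : EuclideanSpace ℝ (Fin d)) :
    volume {s | (s ∈ G ∧ dist s x < 2 * r) ∧ dist (f s) y < 2 * r} ≤
      ENNReal.ofReal ((6 * r / ρ) ^ (d + 1) * m) := by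
  let J : ℝ → Finset ℤ := fun z => Finset.Icc ⌊(z - 2 * r) / ρ⌋ ⌊(z + 2 * r) / ρ⌋
  let Q : Finset (ℤ × (Fin d → ℤ)) := J x ×ˢ Fintype.piFinset fun k => J (y k)
  have hQ : (Q.card : ℝ) ≤ (6 * r / ρ) ^ (d + 1) := by
    rw [Finset.card_product, Fintype.card_piFinset, pow_succ']
    push_cast
    have hJ : ∀ z, ((J z).card : ℝ) ≤ 6 * r / ρ := card_Icc_floor_div_le hρ hr
    refine mul_le_mul (hJ _) ?_ (by positivity) ((Nat.cast_nonneg _).trans (hJ 0))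
    calc ∏ k, ((J (y k)).card : ℝ) ≤ ∏ _k : Fin d, 6 * r / ρ :=
          Finset.prod_le_prod (fun _ _ => Nat.cast_nonneg _) fun k _ => hJ _
      _ = _ := by rw [Finset.prod_const, Finset.card_univ, Fintype.card_fin]
  calc _ ≤ volume (⋃ q ∈ Q, {s | s ∈ G ∧ gridCell ρ s (f s) = q}) := by
        refine measure_mono fun s hs => ?_
        simp only [Set.mem_iUnion]
        refine ⟨gridCell ρ s (f s), ?_, hs.1.1, rfl⟩
        refine Finset.mem_product.2 ⟨floor_div_mem_Icc hρ hs.1.2, ?_⟩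
        refine Fintype.mem_piFinset.2 fun k => floor_div_mem_Icc hρ (lt_of_le_of_lt ?_ hs.2)
        have := PiLp.norm_apply_le (f s - y) k
        rwa [← dist_eq_norm, Real.norm_eq_abs] at this
    _ ≤ ∑ q ∈ Q, volume {s | s ∈ G ∧ gridCell ρ s (f s) = q} := measure_biUnion_finset_le _ _
    _ ≤ ∑ _q ∈ Q, ENNReal.ofReal m := Finset.sum_le_sum fun q _ => hcell q
    _ = ENNReal.ofReal (Q.card * m) := by
        rw [Finset.sum_const, nsmul_eq_mul, ENNReal.ofReal_mul (Nat.cast_nonneg _),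
          ENNReal.ofReal_natCast]
    _ ≤ _ := ENNReal.ofReal_le_ofReal (mul_le_mul_of_nonneg_right hQ hm)

/-- Each constant `C n` works at all small enough scales; a strictly increasing choice of scales `1
/ (k + 1)` also forces `ρ` to 0. -/
lemma exists_mesh_of_tendsto_atTop {d : ℕ} {ψ : ℝ≥0 → ℝ≥0}
    (hlim : Tendsto (fun r : ℝ≥0 => ψ r / r ^ (d + 1)) (𝓝[>] 0) atTop) (C : ℕ → ℝ≥0) :
    ∃ ρ : ℕ → ℝ, (∀ n, 0 < ρ n) ∧ Tendsto ρ atTop (𝓝 0) ∧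
      ∀ n, ∀ r : ℝ≥0, 0 < r → (r : ℝ) < ρ n → C n * r ^ (d + 1) ≤ ψ r := by
  have key : ∀ n, ∀ᶠ k : ℕ in atTop, ∀ r : ℝ≥0, 0 < r → (r : ℝ) < 1 / ((k : ℝ) + 1) →
      C n * r ^ (d + 1) ≤ ψ r := by
    intro n
    obtain ⟨δ, hδ, hsub⟩ := (mem_nhdsGT_iff_exists_Ioo_subset' (zero_lt_one' ℝ≥0)).1
      (hlim.eventually_ge_atTop (C n))
    filter_upwards [(tendsto_one_div_add_atTop_nhds_zero_nat (𝕜 := ℝ)).eventually_lt_const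
      (NNReal.coe_pos.2 hδ)] with k hk r hr hrk
    have : C n ≤ ψ r / r ^ (d + 1) := hsub ⟨hr, NNReal.coe_lt_coe.1 (hrk.trans hk)⟩
    exact (le_div_iff₀ (pow_pos hr _)).1 this
  obtain ⟨φ, hφ, h⟩ := extraction_forall_of_eventually key
  exact ⟨fun n => 1 / ((φ n : ℝ) + 1), fun n => Nat.one_div_pos_of_nat,
    tendsto_one_div_add_atTop_nhds_zero_nat.comp hφ.tendsto_atTop, h⟩

lemma mem_dominatedSet_of_volume_cell_le {d : ℕ} {ψ : ℝ≥0 → ℝ≥0} {ρ a : ℕ → ℝ}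
    (hρ : ∀ n, 0 < ρ n) (ha : ∀ n, 0 < a n) (hρ0 : Tendsto ρ atTop (𝓝 0))
    (hψ : ∀ n, ∀ r : ℝ≥0, 0 < r → (r : ℝ) < ρ n →
      2 * (6 : ℝ) ^ (d + 1) / a (n + 1) ^ d * r ^ (d + 1) ≤ ψ r)
    {G : Set I} {f : C(I, EuclideanSpace ℝ (Fin d))} {N : ℕ}
    (hcell : ∀ n ≥ N, ∀ q, volume {s | s ∈ G ∧ gridCell (ρ n) s (f s) = q} ≤
      ENNReal.ofReal (2 * (ρ n * (ρ n / a n) ^ d))) :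
    f ∈ dominatedSet G ψ (ρ N) := by
  classical
  intro r hr hrN x y
  have hex : ∃ n, N ≤ n ∧ ρ n ≤ r :=
    ((eventually_ge_atTop N).and (hρ0.eventually_le_const (NNReal.coe_pos.2 hr))).exists
  obtain ⟨hmN, hmr⟩ := Nat.find_spec hex
  -- The first mesh from `N` on that is at most `r`. As `r < ρ N`, it has a predecessor `n ≥ N` with
  -- `r < ρ n`: cells are counted at scale `n + 1` but the gauge is compared at scale `n`, hence `a
  -- (n + 1)` in the hypothesis.
  set m := Nat.find hex with hm
  have hlt : N < m := lt_of_le_of_ne hmN fun h => (h ▸ hrN).not_ge hmr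
  obtain ⟨n, hn⟩ : ∃ n, m = n + 1 := Nat.exists_eq_succ_of_ne_zero (by omega)
  have hrn : (r : ℝ) < ρ n := by
    have := Nat.find_min hex (m := n) (by omega)
    push Not at this
    exact this (by omega)
  have hρm := hρ m
  have ham := ha m
  refine (volume_ball_le_of_volume_cell_le (hρ m) hmr (by positivity) (hcell m hmN) x y).trans ?_
  rw [← ENNReal.ofReal_coe_nnreal]
  refine ENNReal.ofReal_le_ofReal (le_of_eq_of_le ?_ (hψ n r hr hrn))
  rw [← hn, div_pow, div_pow, mul_pow, pow_succ (ρ m)]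
  field_simp

/-! ### The random function and the conclusion -/

lemma volume_iInter_pos {ε : ℕ → ℝ≥0∞} (hε : ∑' n, ε n < 1) {G : ℕ → Set I}
    (hG : ∀ n, volume (G n)ᶜ ≤ ε n) : 0 < volume (⋂ n, G n) := by
  refine pos_iff_ne_zero.2 fun h0 => ?_
  have h1 : volume (⋂ n, G n)ᶜ ≤ ∑' n, ε n := by
    rw [Set.compl_iInter]
    exact (measure_iUnion_le _).trans (ENNReal.tsum_le_tsum hG)
  have h2 : (1 : ℝ≥0∞) ≤ volume (⋂ n, G n) + volume (⋂ n, G n)ᶜ := by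
    rw [← measure_univ (μ := (volume : Measure I)), ← Set.union_compl_self (⋂ n, G n)]
    exact measure_union_le _ _
  rw [h0, zero_add] at h2
  exact (h2.trans h1).not_gt hε

/-- A random function whose translates almost surely have a graph of positive `ψ`-measure. -/
lemma exists_random_function {d : ℕ} {ψ : ℝ≥0 → ℝ≥0}
    (hlim : Tendsto (fun r : ℝ≥0 => ψ r / r ^ (d + 1)) (𝓝[>] 0) atTop) :
    ∃ (G : Set I) (ρ : ℕ → ℝ)
      (P : Measure (ℕ → ℕ → Fin d → I)) (F : (ℕ → ℕ → Fin d → I) → C(I, EuclideanSpace ℝ (Fin d))),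
      0 < volume G ∧ (∀ n, 0 < ρ n) ∧ IsProbabilityMeasure P ∧ Continuous F ∧
      ∀ x, ∀ᵐ ω ∂P, ∃ N, F ω - x ∈ dominatedSet G ψ (ρ N) := by
  let a : ℕ → ℝ := fun n => (1 / 2 : ℝ) ^ n
  have ha : ∀ n, 0 < a n := fun n => by positivity
  -- The constants involve only the weights, so the meshes can be fixed before the block lengths.
  obtain ⟨ρ, hρ, hρ0, hψ⟩ := exists_mesh_of_tendsto_atTop hlim
    fun n => (2 * (6 : ℝ) ^ (d + 1) / a (n + 1) ^ d).toNNReal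
  let c : ℕ → ℝ := fun n => ρ n * (ρ n / a n) ^ d
  have hc : ∀ n, 0 < c n := fun n => by
    have := hρ n; have := ha n; positivity
  -- Chosen so that the failure probability `b n / c n ^ 2` is the summable `(1 / 2) ^ n`.
  let b : ℕ → ℝ := fun n => c n ^ 2 * (1 / 2 : ℝ) ^ n
  have hb : ∀ n, 0 < b n := fun n => by
    have := hc n; positivity
  obtain ⟨ε, hε0, hε⟩ := ENNReal.exists_pos_sum_of_countable' (one_ne_zero : (1 : ℝ≥0∞) ≠ 0) ℕ
  choose M ι G X hX hG using fun n => exists_isBlockField d (hb n) (hε0 n).ne'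
  let π : Measure (ℕ → Fin d → I) := Measure.infinitePi fun _ => volume
  let P : Measure (ℕ → ℕ → Fin d → I) := Measure.infinitePi fun _ => π
  let F : (ℕ → ℕ → Fin d → I) → C(I, EuclideanSpace ℝ (Fin d)) := geometricSum fun n => X n
  have hnorm : ∀ n u, ‖X n u‖ ≤ √d := fun n => (hX n).norm_le
  have hF : Continuous F := continuous_geometricSum hnorm fun n => (X n).continuous
  refine ⟨⋂ n, G n, ρ, P, F, volume_iInter_pos hε hG, hρ, inferInstance, hF, fun x => ?_⟩
  let T : ℕ → Set (ℕ → ℕ → Fin d → I) := fun n => {ω | ∃ q, ENNReal.ofReal (2 * c n) <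
    volume {s | s ∈ G n ∧ gridCell (ρ n) s ((F ω - x) s) = q}}
  have hTm : ∀ n, MeasurableSet (T n) := by
    intro n
    have hT : T n = ⋃ q, {ω | ENNReal.ofReal (2 * c n) <
        volume {s | s ∈ G n ∧ gridCell (ρ n) s ((F ω - x) s) = q}} := Set.ofPred_exists _
    rw [hT]
    exact MeasurableSet.iUnion fun q => measurableSet_lt measurable_const
      (measurable_measure_prodMk_left (measurableSet_gridCell_eq (ρ n) (hX n).measurableSet
        (hF.sub continuous_const) q))
  have hTP : ∀ n, P (T n) ≤ ENNReal.ofReal ((1 / 2 : ℝ) ^ n) := by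
    intro n
    -- With the other coordinates frozen, the remaining terms and `-x` form the deterministic shift
    -- `h`.
    refine infinitePi_le_of_forall_update (fun _ => π) n (hTm n) fun ω => ?_
    have key := (hX n).measure_exists_lt_volume_cell_le (hb n).le (hρ n) (ha n) rfl
      (F ω - a n • X n (ω n) - x)
    have hbc : b n / c n ^ 2 = (1 / 2 : ℝ) ^ n :=
      mul_div_cancel_left₀ _ (pow_ne_zero 2 (hc n).ne')
    change π _ ≤ ENNReal.ofReal (b n / c n ^ 2) at key
    rw [hbc] at key
    refine le_of_eq_of_le (congrArg π ?_) key
    ext u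
    have : F (Function.update ω n u) - x = a n • X n u + (F ω - a n • X n (ω n) - x) := by
      change geometricSum (fun n => X n) _ - x = _
      rw [geometricSum_update hnorm ω n u, add_sub_assoc]
    change (∃ q, _ < volume {s | s ∈ G n ∧ gridCell (ρ n) s ((F (Function.update ω n u) - x) s) = q})
      ↔ _
    rw [this]
    rfl
  have hsum : ∑' n, P (T n) ≠ ∞ := by
    refine ne_top_of_le_ne_top ?_ (ENNReal.tsum_le_tsum hTP)
    exact summable_geometric_two.tsum_ofReal_ne_top
  filter_upwards [ae_eventually_notMem hsum] with ω hω
  obtain ⟨N, hN⟩ := eventually_atTop.1 hω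
  refine ⟨N, mem_dominatedSet_of_volume_cell_le hρ ha hρ0 (fun n r hr hrn => ?_) fun n hn q => ?_⟩
  · have := NNReal.coe_le_coe.2 (hψ n r hr hrn)
    have han := ha (n + 1)
    rwa [NNReal.coe_mul, Real.coe_toNNReal _ (by positivity), NNReal.coe_pow] at this
  · have hq := hN n hn
    simp only [T, Set.mem_ofPred_eq, not_exists, not_lt] at hq
    refine le_trans (measure_mono fun s hs => ?_) (hq q)
    exact ⟨Set.mem_iInter.1 hs.1 n, hs.2⟩

theorem theoremt (d : ℕ) (hd : 1 ≤ d) (ψ : ℝ≥0 → ℝ≥0) (hψ : IsGauge ψ)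
    (hlim : Tendsto (fun r : ℝ≥0 => ψ r / r ^ (d + 1)) (𝓝[>] 0) atTop) :
    IsPrevalent {f : C(I, EuclideanSpace ℝ (Fin d)) | 0 < gaugeHausdorff ψ (graphSet f)} := by
  obtain ⟨G, ρ, P, F, hG, hρ, hP, hF, hae⟩ := exists_random_function hlim
  let _ : MeasurableSpace C(I, EuclideanSpace ℝ (Fin d)) := borel _
  have : BorelSpace C(I, EuclideanSpace ℝ (Fin d)) := ⟨rfl⟩
  have hB : MeasurableSet (⋃ N, dominatedSet (d := d) G ψ (ρ N))ᶜ :=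
    (MeasurableSet.iUnion fun N => (isClosed_dominatedSet G ψ (ρ N)).measurableSet).compl
  -- The complement of a countable union of closed sets is Borel; its translate by `x` is hit
  -- exactly when `F ω - x` is dominated at no scale `ρ N`.
  refine ⟨(⋃ N, dominatedSet G ψ (ρ N))ᶜ, P.map F, hB, ?_, ?_, fun x => ?_⟩
  · rw [Measure.map_apply hF.measurable MeasurableSet.univ, Set.preimage_univ, measure_univ]
  · refine Set.compl_subset_compl.2 (Set.iUnion_subset fun N f hf => ?_)
    exact hG.trans_le (volume_le_gaugeHausdorff_graphSet (hρ N) hf)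
  · have himage : (fun b => b + x) '' (⋃ N, dominatedSet (d := d) G ψ (ρ N))ᶜ =
        (fun f => f - x) ⁻¹' (⋃ N, dominatedSet G ψ (ρ N))ᶜ := by
      ext f
      simp only [Set.mem_image, Set.mem_preimage]
      exact ⟨by rintro ⟨g, hg, rfl⟩; rwa [add_sub_cancel_right],
        fun hf => ⟨f - x, hf, sub_add_cancel f x⟩⟩
    have hm : Measurable fun f : C(I, EuclideanSpace ℝ (Fin d)) => f - x :=
      (continuous_id.sub continuous_const).measurable
    rw [himage, Measure.map_apply hF.measurable (hm hB)]
    refine measure_mono_null ?_ (ae_iff.1 (hae x))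
    intro ω hω hN
    exact hω (Set.mem_iUnion.2 hN)
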